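/- Let a group $Q$ act by automorphisms on a group $G$, and let $A$ be an abelian group. Let $C_\bullet(G;A)$ be the (unnormalized) bar complex, $C_i(G;A)=\mathbb Z\{[g_1|\cdots|g_i] : g_j\in G\}\otimes A$, with differential induced by $$d[g_1|\cdots|g_i]=[g_2|\cdots|g_i]+\sum_{k=1}^{i-1}(-1)^k[g_1|\cdots|g_kg_{k+1}|\cdots|g_i]+(-1)^i[g_1|\cdots|g_{i-1}],$$ and with the $Q$-action $q([g_1|\cdots|g_i]\otimes a)=[q(g_1)|\cdots|q(g_i)]\otimes a$. Let $C_\bullet(G;A)^Q$ be the subcomplex of $Q$-invariant chains, let $H_i^Q(G;A)$ be its $i$-th homology group, and let $\tilde H_i^Q(G;A)$ be the corresponding reduced group, i.e. the homology at $C_i(G;A)^Q$ of the augmented complex $\cdots\to C_1(G;A)^Q\to C_0(G;A)^Q\to A\to 0$, where $C_0(G;A)^Q\to A$ is $[\,]\otimes a\mapsto a$. **Theorem.** Let $\mathbb Z/2$ act on $\mathbb Z$ by $n\mapsto -n$. Then for every $i>0$, $$H_i^{\mathbb Z/2}(\mathbb Z;\mathbb Z)\cong\begin{cases}\mathbb Z/2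 & i \text{ odd}\\ 0 & i\text{ even,}\end{cases}$$ and for every $i\ge 0$, $$\tilde H_i^{\mathbb Z/2}(\mathbb Z;\mathbb Z)\cong\begin{cases}\mathbb Z/2 & i \text{ odd}\\ 0 & i\text{ even.}\end{cases}$$ -/

import Mathlib

open CategoryTheory

noncomputable section

namespace EquivariantBar

/-- The group `Cₙ(G; A) = ℤ[Gⁿ] ⊗ A` of bar chains, written as finitely supported functions
`Gⁿ → A` (the generator `[g₁|⋯|gₙ] ⊗ a` is `Finsupp.single g a`), with the action
`q • ([g₁|⋯|gₙ] ⊗ a) = [q(g₁)|⋯|q(gₙ)] ⊗ a` of a group `Q` acting on `G` through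
`φ : Q →* MulAut G`. -/
def chainAction {Q G : Type} [Group Q] [Group G] (φ : Q →* MulAut G) (A : Type) [AddCommGroup A]
    (n : ℕ) : Representation ℤ Q ((Fin n → G) →₀ A) where
  toFun q := Finsupp.lmapDomain A ℤ (fun g i => φ q (g i))
  map_one' := by
    ext g a : 2
    simp
  map_mul' q r := by
    ext g a : 2
    simp [Finsupp.mapDomain_single]

theorem chainAction_single {Q G : Type} [Group Q] [Group G] (φ : Q →* MulAut G) (A : Type)
    [AddCommGroup A] (n : ℕ) (q : Q) (g : Fin n → G) (a : A) :
    chainAction φ A n q (Finsupp.single g a) = Finsupp.single (fun i => φ q (g i)) a := by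
  simp [chainAction, Finsupp.mapDomain_single]

/-- The differential `Cₙ₊₁(G; A) → Cₙ(G; A)` of the (unnormalized) bar complex. -/
def chainD (G : Type) [Group G] (A : Type) [AddCommGroup A] (n : ℕ) :
    ((Fin (n + 1) → G) →₀ A) →ₗ[ℤ] ((Fin n → G) →₀ A) :=
  (groupHomology.inhomogeneousChains.d (Rep.trivial ℤ G A) n).hom

theorem chainD_single (G : Type) [Group G] (A : Type) [AddCommGroup A] (n : ℕ)
    (g : Fin (n + 1) → G) (a : A) :
    chainD G A n (Finsupp.single g a) = Finsupp.single (fun i => g i.succ) a +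
      ∑ j : Fin (n + 1),
        (-1 : ℤ) ^ ((j : ℕ) + 1) • Finsupp.single (Fin.contractNth j (· * ·) g) a :=
  groupHomology.inhomogeneousChains.d_single (A := Rep.trivial ℤ G A) n g a

theorem chainD_comp_chainD (G : Type) [Group G] (A : Type) [AddCommGroup A] (n : ℕ) :
    chainD G A n ∘ₗ chainD G A (n + 1) = 0 :=
  congrArg ModuleCat.Hom.hom
    (groupHomology.inhomogeneousChains.d_comp_d (A := Rep.trivial ℤ G A) (n := n))

theorem chainD_comm {Q G : Type} [Group Q] [Group G] (φ : Q →* MulAut G) (A : Type)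
    [AddCommGroup A] (n : ℕ) (q : Q) :
    chainD G A n ∘ₗ chainAction φ A (n + 1) q = chainAction φ A n q ∘ₗ chainD G A n := by
  refine Finsupp.lhom_ext fun g a => ?_
  simp only [LinearMap.comp_apply, chainAction_single, chainD_single, map_add, map_sum, map_smul]
  congr 1
  refine Finset.sum_congr rfl fun j _ => ?_
  have h := Fin.comp_contractNth (· * ·) (· * ·) (map_mul (φ q)) j g
  rw [show (fun i => φ q (g i)) = φ q ∘ g from rfl, ← h]
  rfl

/-- The bar complex `C_•(G; A)`, as a complex of representations of `Q`. -/
def barComplex {Q G : Type} [Group Q] [Group G] (φ : Q →* MulAut G) (A : Type)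
    [AddCommGroup A] : ChainComplex (Rep.{0} ℤ Q) ℕ :=
  ChainComplex.of (fun n => Rep.of (chainAction φ A n))
    (fun n => Rep.ofHom ⟨chainD G A n, chainD_comm φ A n⟩) fun n => by
      refine Rep.hom_ext ?_
      exact Representation.IntertwiningMap.ext (chainD_comp_chainD G A n)

/-- The subcomplex `C_•(G; A)^Q` of `Q`-invariant chains. -/
def invariantComplex {Q G : Type} [Group Q] [Group G] (φ : Q →* MulAut G) (A : Type)
    [AddCommGroup A] : ChainComplex (ModuleCat.{0} ℤ) ℕ :=
  ((Rep.invariantsFunctor ℤ Q).mapHomologicalComplex _).obj (barComplex φ A)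

/-- `H_i^Q(G; A)`, the homology of the complex of invariant chains. -/
def equivariantHomology {Q G : Type} [Group Q] [Group G] (φ : Q →* MulAut G) (A : Type)
    [AddCommGroup A] (i : ℕ) : ModuleCat.{0} ℤ :=
  (invariantComplex φ A).homology i

/-- The augmentation `C₀(G; A)^Q → A`, `∑ [ ] ⊗ a ↦ ∑ a`. -/
def augmentation {Q G : Type} [Group Q] [Group G] (φ : Q →* MulAut G) (A : Type)
    [AddCommGroup A] : (invariantComplex φ A).X 0 ⟶ ModuleCat.of ℤ A :=
  ModuleCat.ofHom ((Finsupp.lsum ℤ fun _ : Fin 0 → G => (LinearMap.id : A →ₗ[ℤ] A)) ∘ₗ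
    (chainAction φ A 0).invariants.subtype)

theorem d_comp_augmentation {Q G : Type} [Group Q] [Group G] (φ : Q →* MulAut G) (A : Type)
    [AddCommGroup A] : (invariantComplex φ A).d 1 0 ≫ augmentation φ A = 0 := by
  have h : (Finsupp.lsum ℤ fun _ : Fin 0 → G => (LinearMap.id : A →ₗ[ℤ] A)) ∘ₗ chainD G A 0
      = 0 := by
    refine Finsupp.lhom_ext fun g a => ?_
    simp only [LinearMap.comp_apply, chainD_single, map_add, map_sum, map_smul,
      Finsupp.lsum_single]
    simp
  have hd : (barComplex φ A).d 1 0 = Rep.ofHom ⟨chainD G A 0, chainD_comm φ A 0⟩ :=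
    
    ChainComplex.of_d (fun n => Rep.of (chainAction φ A n))
      (fun n => Rep.ofHom ⟨chainD G A n, chainD_comm φ A n⟩) 0
  have hd' : (invariantComplex φ A).d 1 0 = (Rep.invariantsFunctor ℤ Q).map
    (Rep.ofHom ⟨chainD G A 0, chainD_comm φ A 0⟩) := by rw [← hd]; rfl
  rw [hd']
  ext x
  exact LinearMap.congr_fun h x.1

/-- The reduced group `H̃_i^Q(G; A)`: the homology at `C_i(G; A)^Q` of the augmented complex
`⋯ → C₁(G; A)^Q → C₀(G; A)^Q → A → 0` (in `ChainComplex.augment` indices are shifted by one). -/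
def reducedEquivariantHomology {Q G : Type} [Group Q] [Group G] (φ : Q →* MulAut G) (A : Type)
    [AddCommGroup A] (i : ℕ) : ModuleCat.{0} ℤ :=
  ((invariantComplex φ A).augment (augmentation φ A) (d_comp_augmentation φ A)).homology (i + 1)

/-- The action of `ℤ/2` on `ℤ` (both written multiplicatively) whose nontrivial element is
`n ↦ -n`. -/
def negAction : Multiplicative (ZMod 2) →* MulAut (Multiplicative ℤ) where
  toFun q := if q = 1 then 1 else MulEquiv.inv (Multiplicative ℤ)
  map_one' := if_pos rfl
  map_mul' := by
    have hinv : MulEquiv.inv (Multiplicative ℤ) * MulEquiv.inv (Multiplicative ℤ) = 1 := by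
      ext x
      simp
    have h : ∀ q : Multiplicative (ZMod 2), q = 1 ∨ q = Multiplicative.ofAdd 1 := by decide
    have h1 : (Multiplicative.ofAdd 1 : Multiplicative (ZMod 2)) ≠ 1 := by decide
    have h2 : (Multiplicative.ofAdd 1 : Multiplicative (ZMod 2)) * Multiplicative.ofAdd 1 = 1 := by
      decide
    intro q r
    rcases h q with rfl | rfl <;> rcases h r with rfl | rfl <;> simp [h1, h2, hinv]

theorem negAction_ofAdd_one (n : ℤ) :
    negAction (Multiplicative.ofAdd 1) (Multiplicative.ofAdd n) = Multiplicative.ofAdd (-n) := by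
  have h1 : (Multiplicative.ofAdd 1 : Multiplicative (ZMod 2)) ≠ 1 := by decide
  simp [negAction, h1]

end EquivariantBar

end

/-! The bar complex of `ℤ` has homology `ℤ` in degree one, detected by `degreeOne`, and none above;
this comes from an explicit homotopy (`chainD_barHomotopy_add`, `exists_chainD_eq_sub`). Write `τ`
for negation on chains, and `P` for the idempotent chain map induced by the zero endomorphism of
`ℤ`. The image of `P` is the bar complex of the trivial group: it is `τ`-fixed and acyclic in
positive degrees. Its complement `M = ker P` has basis `g - 1` for `g ≠ 1`, which `τ` permutes
freely.

For a sign `ε`, let `M^ε` be the part of `M` where `τ = ε`. Freeness (`exists_eq_add_smul_chainNeg`)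
gives short exact sequences `0 → M^(-ε) → M → M^ε → 0` with second map `1 + ετ`. Since `M` is
acyclic above degree one, the connecting map shifts degree and flips the sign, so two shifts give
period two for `M^+` (`SignedTwo.succ`, `SignedExact.succ`).

It remains to start the induction. Negation reverses degree, so cycles in `M^-` have even degree,
while a degree-one cycle of `M` exists. Thus `H₁(M^-) → H₁(M) = ℤ` has image `2ℤ` and is injective,
which gives `H₁(M^+) = ℤ/2` and `H₂(M^+) = 0` (`signedTwo_one_zero`, `signedExact_one_one`). The
proof chases elements through these sequences and then adds the image of `P` back. -/

noncomputable section

namespace EquivariantBar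

/-! ### The bar differential as a recursion on the first entry -/

section Cons

/-- Prepend `a` to every generator: `[g₁|⋯|gₙ] ↦ [a|g₁|⋯|gₙ]`. -/
def chainCons {G : Type} (a : G) (n : ℕ) : ((Fin n → G) →₀ ℤ) →ₗ[ℤ] ((Fin (n + 1) → G) →₀ ℤ) :=
  Finsupp.lmapDomain ℤ ℤ (fun g => (Fin.cons a g : Fin (n + 1) → G))

@[simp] theorem chainCons_single {G : Type} (a : G) (n : ℕ) (g : Fin n → G) (m : ℤ) :
    chainCons a n (Finsupp.single g m) = Finsupp.single (Fin.cons a g : Fin (n + 1) → G) m := by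
  simp [chainCons, Finsupp.mapDomain_single]

theorem lhom_ext_cons {G : Type} {n : ℕ} {M : Type} [AddCommGroup M]
    {f f' : ((Fin (n + 1) → G) →₀ ℤ) →ₗ[ℤ] M}
    (h : ∀ (a : G) (x : (Fin n → G) →₀ ℤ), f (chainCons a n x) = f' (chainCons a n x)) :
    f = f' := by
  refine Finsupp.lhom_ext fun g m => ?_
  have := h (g 0) (Finsupp.single (Fin.tail g) m)
  simpa only [chainCons_single, Fin.cons_self_tail] using this

variable {G : Type} [Group G]

/-- Multiply the first entry of every generator by `a`: `[g₁|⋯|gₙ] ↦ [ag₁|⋯|gₙ]`. -/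
def chainMul (a : G) (n : ℕ) : ((Fin (n + 1) → G) →₀ ℤ) →ₗ[ℤ] ((Fin (n + 1) → G) →₀ ℤ) :=
  Finsupp.lmapDomain ℤ ℤ (fun g => (Fin.cons (a * g 0) (Fin.tail g) : Fin (n + 1) → G))

/-- The bar differential without its first face. -/
def chainDTail (G : Type) [Group G] (n : ℕ) :
    ((Fin (n + 1) → G) →₀ ℤ) →ₗ[ℤ] ((Fin n → G) →₀ ℤ) :=
  chainD G ℤ n - Finsupp.lmapDomain ℤ ℤ (fun g : Fin (n + 1) → G => (Fin.tail g : Fin n → G))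

@[simp] theorem chainMul_cons_single (a b : G) (n : ℕ) (g : Fin n → G) (m : ℤ) :
    chainMul a n (Finsupp.single (Fin.cons b g : Fin (n + 1) → G) m) =
      Finsupp.single (Fin.cons (a * b) g : Fin (n + 1) → G) m := by
  simp [chainMul, Finsupp.mapDomain_single]

theorem chainMul_chainCons (a b : G) (n : ℕ) (x : (Fin n → G) →₀ ℤ) :
    chainMul a n (chainCons b n x) = chainCons (a * b) n x := by
  have h : chainMul a n ∘ₗ chainCons b n = chainCons (a * b) n :=
    Finsupp.lhom_ext fun g m => by simp
  exact LinearMap.congr_fun h x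

theorem chainMul_one (n : ℕ) (x : (Fin (n + 1) → G) →₀ ℤ) : chainMul 1 n x = x := by
  have h : chainMul (1 : G) n = LinearMap.id :=
    lhom_ext_cons fun a x => by simp [chainMul_chainCons]
  exact LinearMap.congr_fun h x

theorem contractNth_zero_cons_cons (a b : G) {n : ℕ} (g : Fin n → G) :
    Fin.contractNth (0 : Fin (n + 2)) (· * ·) (Fin.cons a (Fin.cons b g : Fin (n + 1) → G)) =
      (Fin.cons (a * b) g : Fin (n + 1) → G) := by
  funext i
  refine Fin.cases ?_ (fun i => ?_) i
  · rw [Fin.contractNth_apply_of_eq _ _ _ _ (by simp)]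
    simp
  · rw [Fin.contractNth_apply_of_gt _ _ _ _ (by simp)]
    simp

theorem contractNth_succ_cons (a : G) {n : ℕ} (j : Fin (n + 1)) (g : Fin (n + 1) → G) :
    Fin.contractNth j.succ (· * ·) (Fin.cons a g : Fin (n + 2) → G) =
      (Fin.cons a (Fin.contractNth j (· * ·) g) : Fin (n + 1) → G) := by
  funext i
  refine Fin.cases ?_ (fun i => ?_) i
  · rw [Fin.contractNth_apply_of_lt _ _ _ _ (by simp)]
    simp
  · rcases lt_trichotomy (i : ℕ) j with h | h | h
    · rw [Fin.contractNth_apply_of_lt _ _ _ _ (by simpa using h), ← Fin.succ_castSucc, Fin.cons_succ,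
        Fin.cons_succ, Fin.contractNth_apply_of_lt _ _ _ _ h]
    · rw [Fin.contractNth_apply_of_eq _ _ _ _ (by simpa using h), Fin.cons_succ, Fin.cons_succ,
        Fin.contractNth_apply_of_eq _ _ _ _ h, ← Fin.succ_castSucc, Fin.cons_succ]
    · rw [Fin.contractNth_apply_of_gt _ _ _ _ (by simpa using h), Fin.cons_succ, Fin.cons_succ,
        Fin.contractNth_apply_of_gt _ _ _ _ h]

theorem chainD_eq_tail_add (n : ℕ) (x : (Fin (n + 1) → G) →₀ ℤ) :
    chainD G ℤ n x = Finsupp.lmapDomain ℤ ℤ (fun g : Fin (n + 1) → G => (Fin.tail g : Fin n → G)) x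
      + chainDTail G n x := by
  simp [chainDTail]

theorem chainDTail_single (n : ℕ) (g : Fin (n + 1) → G) (m : ℤ) :
    chainDTail G n (Finsupp.single g m) = ∑ j : Fin (n + 1),
        (-1 : ℤ) ^ ((j : ℕ) + 1) • Finsupp.single (Fin.contractNth j (· * ·) g) m := by
  rw [chainDTail, LinearMap.sub_apply, chainD_single, Finsupp.lmapDomain_apply,
    Finsupp.mapDomain_single]
  exact add_sub_cancel_left _ _

/-- Of the faces other than the first, only the one merging the first two entries touches `a`; the
others act behind `a`, with index and hence sign shifted by one. -/
theorem chainDTail_chainCons (a : G) (n : ℕ) (x : (Fin (n + 1) → G) →₀ ℤ) :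
    chainDTail G (n + 1) (chainCons a (n + 1) x) =
      -chainMul a n x - chainCons a n (chainDTail G n x) := by
  have h : chainDTail G (n + 1) ∘ₗ chainCons a (n + 1) =
      -chainMul a n - chainCons a n ∘ₗ chainDTail G n := by
    refine Finsupp.lhom_ext fun g m => ?_
    simp only [LinearMap.comp_apply, LinearMap.sub_apply, LinearMap.neg_apply, chainCons_single,
      chainDTail_single, map_sum, map_smul]
    rw [Fin.sum_univ_succ, sub_eq_add_neg, ← Finset.sum_neg_distrib]
    congr 1
    · obtain ⟨b, s, rfl⟩ : ∃ b s, g = (Fin.cons b s : Fin (n + 1) → G) :=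
        ⟨g 0, Fin.tail g, (Fin.cons_self_tail g).symm⟩
      rw [contractNth_zero_cons_cons, chainMul_cons_single]
      simp
    · refine Finset.sum_congr rfl fun j _ => ?_
      rw [contractNth_succ_cons, Fin.val_succ, pow_succ _ ((j : ℕ) + 1), mul_neg_one, neg_smul]
  exact LinearMap.congr_fun h x

theorem chainD_chainCons (a : G) (n : ℕ) (x : (Fin (n + 1) → G) →₀ ℤ) :
    chainD G ℤ (n + 1) (chainCons a (n + 1) x) =
      x - chainMul a n x - chainCons a n (chainDTail G n x) := by
  have h : Finsupp.lmapDomain ℤ ℤ (fun g : Fin (n + 2) → G => (Fin.tail g : Fin (n + 1) → G)) ∘ₗ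
      chainCons a (n + 1) = LinearMap.id := by
    refine Finsupp.lhom_ext fun g m => ?_
    simp [Finsupp.mapDomain_single]
  have hx := LinearMap.congr_fun h x
  simp only [LinearMap.comp_apply, LinearMap.id_apply] at hx
  rw [chainD_eq_tail_add, hx, chainDTail_chainCons]
  abel

end Cons

/-! ### Homology of the bar complex of the integers -/

section Integers

open Multiplicative

/-- The maps `[g₂|⋯] ↦ h[g|g₂|⋯]` out of which the contracting homotopy `h` of the bar complex
of `ℤ` (in degrees at least two) is built; here `g = k` is an integer. -/
def homotopyCons (n : ℕ) (k : ℤ) :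
    ((Fin n → Multiplicative ℤ) →₀ ℤ) →ₗ[ℤ] ((Fin (n + 2) → Multiplicative ℤ) →₀ ℤ) :=
  ∑ i ∈ Finset.Ico 0 k, chainCons (ofAdd 1) (n + 1) ∘ₗ chainCons (ofAdd i) n -
    ∑ i ∈ Finset.Ico k 0, chainCons (ofAdd 1) (n + 1) ∘ₗ chainCons (ofAdd i) n -
    chainCons 1 (n + 1) ∘ₗ chainCons 1 n

theorem homotopyCons_zero (n : ℕ) :
    homotopyCons n 0 = -(chainCons 1 (n + 1) ∘ₗ chainCons 1 n) := by
  simp [homotopyCons]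

theorem homotopyCons_add_one (n : ℕ) (k : ℤ) :
    homotopyCons n (k + 1) =
      homotopyCons n k + chainCons (ofAdd 1) (n + 1) ∘ₗ chainCons (ofAdd k) n := by
  unfold homotopyCons
  rcases le_or_gt 0 k with h | h
  · have h1 : Finset.Ico 0 (k + 1) = insert k (Finset.Ico 0 k) := by
      ext i; simp only [Finset.mem_insert, Finset.mem_Ico]; omega
    rw [h1, Finset.sum_insert (by simp), Finset.Ico_eq_empty_of_le h,
      Finset.Ico_eq_empty_of_le (by omega : (0 : ℤ) ≤ k + 1)]
    abel
  · have h1 : Finset.Ico k 0 = insert k (Finset.Ico (k + 1) 0) := by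
      ext i; simp only [Finset.mem_insert, Finset.mem_Ico]; omega
    rw [h1, Finset.sum_insert (by simp), Finset.Ico_eq_empty_of_le h.le,
      Finset.Ico_eq_empty_of_le (by omega : k + 1 ≤ (0 : ℤ))]
    abel

/-- A homotopy between `0` and `-1` on the bar complex of `ℤ` in degrees at least two. -/
def barHomotopy (n : ℕ) : ((Fin (n + 1) → Multiplicative ℤ) →₀ ℤ) →ₗ[ℤ]
    ((Fin (n + 2) → Multiplicative ℤ) →₀ ℤ) :=
  Finsupp.lsum ℤ fun g => homotopyCons n (toAdd (g 0)) ∘ₗ Finsupp.lsingle (Fin.tail g)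

theorem barHomotopy_chainCons (n : ℕ) (a : Multiplicative ℤ)
    (x : (Fin n → Multiplicative ℤ) →₀ ℤ) :
    barHomotopy n (chainCons a n x) = homotopyCons n (toAdd a) x := by
  have h : barHomotopy n ∘ₗ chainCons a n = homotopyCons n (toAdd a) :=
    Finsupp.lhom_ext fun g m => by simp [barHomotopy]
  exact LinearMap.congr_fun h x

theorem barHomotopy_chainMul_add_one (n : ℕ) (k : ℤ)
    (x : (Fin (n + 1) → Multiplicative ℤ) →₀ ℤ) :
    barHomotopy n (chainMul (ofAdd (k + 1)) n x) = barHomotopy n (chainMul (ofAdd k) n x) +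
      chainCons (ofAdd 1) (n + 1) (chainMul (ofAdd k) n x) := by
  have h : barHomotopy n ∘ₗ chainMul (ofAdd (k + 1)) n = barHomotopy n ∘ₗ chainMul (ofAdd k) n +
      chainCons (ofAdd 1) (n + 1) ∘ₗ chainMul (ofAdd k) n := by
    refine lhom_ext_cons fun a x => ?_
    have e : toAdd (ofAdd (k + 1) * a) = toAdd (ofAdd k * a) + 1 := by
      simp only [toAdd_mul, toAdd_ofAdd]; ring
    simp only [LinearMap.add_apply, LinearMap.comp_apply, chainMul_chainCons,
      barHomotopy_chainCons, e, homotopyCons_add_one, ofAdd_toAdd]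
  exact LinearMap.congr_fun h x

/-- Passing from `k` to `k + 1` adds `[1|k|x]`, whose boundary turns `-[k|x]` into `-[k+1|x]` and
supplies the increments of the other terms. The case `k = 0` is why `homotopyCons` contains
`-[0|0|x]`: in the unnormalized complex `[0|x]` is not zero and must be bounded too. -/
theorem chainD_homotopyCons (n : ℕ) (k : ℤ) (x : (Fin (n + 1) → Multiplicative ℤ) →₀ ℤ) :
    chainD (Multiplicative ℤ) ℤ (n + 2) (homotopyCons (n + 1) k x) =
      -chainCons (ofAdd k) (n + 1) x + barHomotopy n (chainMul (ofAdd k) n x) - barHomotopy n x +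
        homotopyCons n k (chainDTail (Multiplicative ℤ) n x) := by
  have step (k : ℤ) : chainD (Multiplicative ℤ) ℤ (n + 2)
      (chainCons (ofAdd 1) (n + 2) (chainCons (ofAdd k) (n + 1) x)) =
      chainCons (ofAdd k) (n + 1) x - chainCons (ofAdd (k + 1)) (n + 1) x +
        chainCons (ofAdd 1) (n + 1) (chainMul (ofAdd k) n x) +
        chainCons (ofAdd 1) (n + 1) (chainCons (ofAdd k) n
          (chainDTail (Multiplicative ℤ) n x)) := by
    rw [chainD_chainCons, chainMul_chainCons, chainDTail_chainCons, ← ofAdd_add, add_comm 1 k,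
      map_sub, map_neg]
    abel
  induction k using Int.induction_on with
  | zero =>
    simp only [homotopyCons_zero, ofAdd_zero, chainMul_one, LinearMap.neg_apply,
      LinearMap.comp_apply, map_neg, chainD_chainCons, chainMul_chainCons, chainDTail_chainCons,
      map_sub, mul_one]
    abel
  | succ k ih =>
    rw [homotopyCons_add_one, homotopyCons_add_one, barHomotopy_chainMul_add_one]
    simp only [LinearMap.add_apply, LinearMap.comp_apply, map_add, ih, step]
    abel
  | pred k ih =>
    -- The downward step is the same recurrence, read from `l + 1` to `l`.
    obtain ⟨l, hl⟩ : ∃ l : ℤ, -(k : ℤ) = l + 1 := ⟨-k - 1, by ring⟩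
    rw [hl] at ih ⊢
    rw [add_sub_cancel_right]
    rw [homotopyCons_add_one, homotopyCons_add_one, barHomotopy_chainMul_add_one] at ih
    simp only [LinearMap.add_apply, LinearMap.comp_apply, map_add, step] at ih
    rw [← sub_eq_zero] at ih ⊢
    rw [← ih]
    abel

theorem chainD_barHomotopy_add (n : ℕ) (x : (Fin (n + 2) → Multiplicative ℤ) →₀ ℤ) :
    chainD (Multiplicative ℤ) ℤ (n + 2) (barHomotopy (n + 1) x) +
      barHomotopy n (chainD (Multiplicative ℤ) ℤ (n + 1) x) = -x := by
  have h : chainD (Multiplicative ℤ) ℤ (n + 2) ∘ₗ barHomotopy (n + 1) +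
      barHomotopy n ∘ₗ chainD (Multiplicative ℤ) ℤ (n + 1) = -LinearMap.id := by
    refine lhom_ext_cons fun a x => ?_
    simp only [LinearMap.add_apply, LinearMap.comp_apply, LinearMap.neg_apply, LinearMap.id_apply,
      barHomotopy_chainCons, chainD_homotopyCons, chainD_chainCons, map_sub, ofAdd_toAdd]
    abel
  exact LinearMap.congr_fun h x

/-- The bar complex of `ℤ` is exact in degrees at least two. -/
theorem exists_chainD_eq (n : ℕ) (x : (Fin (n + 2) → Multiplicative ℤ) →₀ ℤ)
    (hx : chainD (Multiplicative ℤ) ℤ (n + 1) x = 0) :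
    ∃ y, chainD (Multiplicative ℤ) ℤ (n + 2) y = x := by
  refine ⟨-barHomotopy (n + 1) x, ?_⟩
  have h := chainD_barHomotopy_add n x
  rw [hx, map_zero, add_zero] at h
  rw [map_neg, h, neg_neg]

/-- The homomorphism `C₁(ℤ; ℤ) → ℤ`, `[k] ↦ k`, which induces `H₁(ℤ; ℤ) ≅ ℤ`. -/
def degreeOne : ((Fin 1 → Multiplicative ℤ) →₀ ℤ) →ₗ[ℤ] ℤ :=
  Finsupp.linearCombination ℤ fun g => toAdd (g 0)

theorem degreeOne_single (g : Fin 1 → Multiplicative ℤ) (m : ℤ) :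
    degreeOne (Finsupp.single g m) = m * toAdd (g 0) := by
  simp [degreeOne]

theorem degreeOne_chainD (x : (Fin 2 → Multiplicative ℤ) →₀ ℤ) :
    degreeOne (chainD (Multiplicative ℤ) ℤ 1 x) = 0 := by
  have h : degreeOne ∘ₗ chainD (Multiplicative ℤ) ℤ 1 = 0 := by
    refine Finsupp.lhom_ext fun g m => ?_
    have e0 : Fin.contractNth 0 (· * ·) g 0 = g 0 * g 1 :=
      Fin.contractNth_apply_of_eq _ _ _ _ rfl
    have e1 : Fin.contractNth 1 (· * ·) g 0 = g 0 :=
      Fin.contractNth_apply_of_lt _ _ _ _ Nat.zero_lt_one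
    rw [LinearMap.comp_apply, chainD_single, Fin.sum_univ_two]
    simp only [map_add, map_smul, degreeOne_single, e0, e1, toAdd_mul]
    simp
    ring
  exact LinearMap.congr_fun h x

/-- The generator `[1]` of `C₁(ℤ; ℤ)`. -/
def genOne : (Fin 1 → Multiplicative ℤ) →₀ ℤ := Finsupp.single (fun _ => ofAdd 1) 1

/-- In degree one the homotopy telescopes the relations `∂[1|k] = [k] - [k+1] + [1]`, reducing every
`[k]` to `k` copies of `[1]`. -/
theorem exists_chainD_eq_sub (x : (Fin 1 → Multiplicative ℤ) →₀ ℤ) :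
    ∃ y, chainD (Multiplicative ℤ) ℤ 1 y = x - degreeOne x • genOne := by
  have key (a b : ℤ) (m : ℤ) : chainD (Multiplicative ℤ) ℤ 1
      (chainCons (ofAdd a) 1 (chainCons (ofAdd b) 0 (Finsupp.single Fin.elim0 m))) =
      Finsupp.single (fun _ => ofAdd b) m - Finsupp.single (fun _ => ofAdd (a + b)) m +
        Finsupp.single (fun _ => ofAdd a) m := by
    rw [chainD_chainCons, chainMul_chainCons, chainCons_single, chainCons_single,
      chainDTail_single, Fin.sum_univ_one]
    have e (c : Multiplicative ℤ) (f : Fin 0 → Multiplicative ℤ) :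
        (Fin.cons c f : Fin 1 → Multiplicative ℤ) = fun _ => c := by
      funext i; rw [Fin.fin_one_eq_zero i]; rfl
    simp [e, ofAdd_add]
  have h1 : ∀ (k : ℤ) (m : ℤ), chainD (Multiplicative ℤ) ℤ 1
      (homotopyCons 0 k (Finsupp.single Fin.elim0 m)) =
        (k * m) • genOne - Finsupp.single (fun _ => ofAdd k) m := by
    have step (k m : ℤ) := key 1 k m
    have g1 (m : ℤ) : Finsupp.single (fun _ => ofAdd 1) m = m • genOne := by
      simp [genOne]
    intro k m
    induction k using Int.induction_on with
    | zero =>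
      have := key 0 0 m
      simp only [ofAdd_zero, add_zero] at this
      simp [homotopyCons_zero, -chainCons_single, this]
    | succ k ih =>
      rw [homotopyCons_add_one]
      simp only [LinearMap.add_apply, LinearMap.comp_apply, map_add, ih, step, g1]
      rw [add_comm 1 (k : ℤ), add_mul, one_mul, add_smul]
      abel
    | pred k ih =>
      obtain ⟨l, hl⟩ : ∃ l : ℤ, -(k : ℤ) = l + 1 := ⟨-k - 1, by ring⟩
      rw [hl] at ih ⊢
      rw [add_sub_cancel_right]
      rw [homotopyCons_add_one] at ih
      simp only [LinearMap.add_apply, LinearMap.comp_apply, map_add, step, g1] at ih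
      rw [add_comm 1 l, add_mul, one_mul, add_smul] at ih
      rw [← sub_eq_zero] at ih ⊢
      rw [← ih]
      abel
  have h2 : chainD (Multiplicative ℤ) ℤ 1 ∘ₗ barHomotopy 0 =
      LinearMap.toSpanSingleton ℤ _ genOne ∘ₗ degreeOne - LinearMap.id := by
    refine Finsupp.lhom_ext fun g m => ?_
    have e : Fin.tail g = Fin.elim0 := Subsingleton.elim _ _
    have e' : g = fun _ => ofAdd (toAdd (g 0)) := by
      funext i; rw [Fin.fin_one_eq_zero i]; rfl
    simp only [barHomotopy, LinearMap.comp_apply, Finsupp.lsum_single, Finsupp.lsingle_apply, e,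
      h1, LinearMap.sub_apply, LinearMap.id_apply, LinearMap.toSpanSingleton_apply,
      ← e']
    rw [degreeOne_single, mul_comm]
  refine ⟨-barHomotopy 0 x, ?_⟩
  have := LinearMap.congr_fun h2 x
  simp only [LinearMap.comp_apply, LinearMap.sub_apply, LinearMap.id_apply,
      LinearMap.toSpanSingleton_apply] at this
  rw [map_neg, this, neg_sub]

end Integers

end EquivariantBar

end

noncomputable section

namespace EquivariantBar

open Multiplicative

/-! ### The involution, the projection to the trivial subgroup, and freeness -/

/-- The involution of the bar chains of `ℤ` induced by `n ↦ -n`. -/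
def chainNeg (n : ℕ) :
    ((Fin n → Multiplicative ℤ) →₀ ℤ) →ₗ[ℤ] ((Fin n → Multiplicative ℤ) →₀ ℤ) :=
  chainAction negAction ℤ n (ofAdd 1)

/-- The endomorphism of the bar chains of `ℤ` induced by the zero endomorphism of `ℤ`. -/
def chainProj (n : ℕ) :
    ((Fin n → Multiplicative ℤ) →₀ ℤ) →ₗ[ℤ] ((Fin n → Multiplicative ℤ) →₀ ℤ) :=
  Finsupp.lmapDomain ℤ ℤ fun _ => 1

theorem chainNeg_single (n : ℕ) (g : Fin n → Multiplicative ℤ) (m : ℤ) :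
    chainNeg n (Finsupp.single g m) = Finsupp.single g⁻¹ m := by
  rw [chainNeg, chainAction_single]
  exact congrArg (Finsupp.single · m) (funext fun i => negAction_ofAdd_one (toAdd (g i)))

theorem chainProj_single (n : ℕ) (g : Fin n → Multiplicative ℤ) (m : ℤ) :
    chainProj n (Finsupp.single g m) = Finsupp.single 1 m := by
  rw [chainProj, Finsupp.lmapDomain_apply, Finsupp.mapDomain_single,
    Pi.one_def]

theorem chainNeg_chainNeg (n : ℕ) (x : (Fin n → Multiplicative ℤ) →₀ ℤ) :
    chainNeg n (chainNeg n x) = x := by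
  have h : chainNeg n ∘ₗ chainNeg n = LinearMap.id :=
    Finsupp.lhom_ext fun g m => by simp [chainNeg_single]
  exact LinearMap.congr_fun h x

theorem chainNeg_chainProj (n : ℕ) (x : (Fin n → Multiplicative ℤ) →₀ ℤ) :
    chainNeg n (chainProj n x) = chainProj n x := by
  have h : chainNeg n ∘ₗ chainProj n = chainProj n :=
    Finsupp.lhom_ext fun g m => by simp [chainNeg_single, chainProj_single]
  exact LinearMap.congr_fun h x

theorem chainProj_chainNeg (n : ℕ) (x : (Fin n → Multiplicative ℤ) →₀ ℤ) :
    chainProj n (chainNeg n x) = chainProj n x := by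
  have h : chainProj n ∘ₗ chainNeg n = chainProj n :=
    Finsupp.lhom_ext fun g m => by simp [chainNeg_single, chainProj_single]
  exact LinearMap.congr_fun h x

theorem chainProj_chainProj (n : ℕ) (x : (Fin n → Multiplicative ℤ) →₀ ℤ) :
    chainProj n (chainProj n x) = chainProj n x := by
  have h : chainProj n ∘ₗ chainProj n = chainProj n :=
    Finsupp.lhom_ext fun g m => by simp [chainProj_single]
  exact LinearMap.congr_fun h x

theorem chainD_chainNeg (n : ℕ) (x : (Fin (n + 1) → Multiplicative ℤ) →₀ ℤ) :
    chainD (Multiplicative ℤ) ℤ n (chainNeg (n + 1) x) =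
      chainNeg n (chainD (Multiplicative ℤ) ℤ n x) :=
  LinearMap.congr_fun (chainD_comm negAction ℤ n (ofAdd 1)) x

theorem chainD_chainProj (n : ℕ) (x : (Fin (n + 1) → Multiplicative ℤ) →₀ ℤ) :
    chainD (Multiplicative ℤ) ℤ n (chainProj (n + 1) x) =
      chainProj n (chainD (Multiplicative ℤ) ℤ n x) := by
  have h : chainD (Multiplicative ℤ) ℤ n ∘ₗ chainProj (n + 1) =
      chainProj n ∘ₗ chainD (Multiplicative ℤ) ℤ n := by
    refine Finsupp.lhom_ext fun g m => ?_
    simp only [LinearMap.comp_apply, chainProj_single, chainD_single, map_add, map_sum, map_smul]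
    congr 1
    refine Finset.sum_congr rfl fun j _ => ?_
    have h := Fin.comp_contractNth (· * ·) (· * ·)
      (map_mul (1 : Multiplicative ℤ →* Multiplicative ℤ)) j g
    congr 2
    exact h.symm
  exact LinearMap.congr_fun h x

theorem chainD_chainD (n : ℕ) (x : (Fin (n + 2) → Multiplicative ℤ) →₀ ℤ) :
    chainD (Multiplicative ℤ) ℤ n (chainD (Multiplicative ℤ) ℤ (n + 1) x) = 0 :=
  LinearMap.congr_fun (chainD_comp_chainD (Multiplicative ℤ) ℤ n) x

theorem chainNeg_apply (n : ℕ) (x : (Fin n → Multiplicative ℤ) →₀ ℤ)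
    (g : Fin n → Multiplicative ℤ) : chainNeg n x g = x g⁻¹ := by
  induction x using Finsupp.induction_linear with
  | zero => simp
  | add x y hx hy => simp [hx, hy]
  | single g' m =>
    rw [chainNeg_single]
    classical
    simp only [Finsupp.single_apply, inv_eq_iff_eq_inv]

/-- The negation acts freely on the bar chains of `ℤ` modulo those of the trivial subgroup. -/
theorem exists_eq_add_smul_chainNeg (n : ℕ) {ε : ℤ} (hε : ε * ε = 1)
    {x : (Fin n → Multiplicative ℤ) →₀ ℤ} (hx : chainNeg n x = ε • x) (hp : chainProj n x = 0) :
    ∃ y, chainProj n y = 0 ∧ x = y + ε • chainNeg n y := by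
  classical
  -- The lexicographic order makes `ℤⁿ` a totally ordered group, so positivity selects one element
  -- from each pair `{g, g⁻¹}` with `g ≠ 1`.
  let pos : (Fin n → Multiplicative ℤ) → Prop := fun g => 0 < toLex (fun i => toAdd (g i))
  have pos_inv (g) : pos g⁻¹ ↔ toLex (fun i => toAdd (g i)) < 0 := by
    change 0 < -toLex (fun i => toAdd (g i)) ↔ _
    exact neg_pos
  let y₀ := x.filter pos
  have hpos {g} (h : pos g) : y₀ g = x g := Finsupp.filter_apply_pos _ _ h
  have hneg {g} (h : ¬pos g) : y₀ g = 0 := Finsupp.filter_apply_neg _ _ h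
  have hr : x - (y₀ + ε • chainNeg n y₀) = Finsupp.single 1 (x 1) := by
    ext g
    simp only [Finsupp.sub_apply, Finsupp.add_apply, Finsupp.smul_apply, chainNeg_apply,
      smul_eq_mul]
    have hxg : x g⁻¹ = ε * x g := by rw [← chainNeg_apply, hx]; rfl
    rcases lt_trichotomy (toLex fun i => toAdd (g i)) 0 with h | h | h
    · have hg : g ≠ 1 := by rintro rfl; exact lt_irrefl _ h
      rw [hneg h.not_gt, hpos ((pos_inv g).2 h), Finsupp.single_eq_of_ne hg, hxg, ← mul_assoc, hε]
      ring
    · have hg : g = 1 := by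
        funext i
        exact congrArg ofAdd (congrFun (toLex.injective h) i)
      rw [hneg h.not_gt, hneg ((pos_inv g).not.2 h.not_lt), hg]
      simp
    · have hg : g ≠ 1 := by rintro rfl; exact lt_irrefl _ h
      rw [hpos h, hneg ((pos_inv g).not.2 h.not_gt), Finsupp.single_eq_of_ne hg]
      simp
  -- The residue in `hr` is supported at `1`, hence fixed by `chainProj`; applying `chainProj` and
  -- using `hp` expresses it through `y₀`.
  have hpr : -(chainProj n y₀ + ε • chainProj n y₀) = x - (y₀ + ε • chainNeg n y₀) := by
    have := congrArg (chainProj n) hr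
    rw [chainProj_single, ← hr, map_sub, map_add, map_smul, chainProj_chainNeg, hp,
      zero_sub] at this
    exact this
  -- This correction both moves `y₀` into the kernel of `chainProj` and absorbs the residue.
  refine ⟨y₀ - chainProj n y₀, by rw [map_sub, chainProj_chainProj, sub_self], ?_⟩
  rw [map_sub, chainNeg_chainProj, smul_sub, ← sub_eq_zero]
  rw [← sub_eq_zero] at hpr
  rw [← neg_eq_zero, ← hpr]
  abel

/-- The bar chains of `ℤ` which are killed by `chainProj` and on which the involution acts by the
sign `ε`. -/
def signedChains (ε : ℤ) (n : ℕ) : Submodule ℤ ((Fin n → Multiplicative ℤ) →₀ ℤ) :=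
  LinearMap.ker (chainProj n) ⊓ LinearMap.ker (chainNeg n - ε • LinearMap.id)

theorem mem_signedChains {ε : ℤ} {n : ℕ} {x : (Fin n → Multiplicative ℤ) →₀ ℤ} :
    x ∈ signedChains ε n ↔ chainProj n x = 0 ∧ chainNeg n x = ε • x := by
  simp [signedChains, sub_eq_zero]

theorem add_smul_chainNeg_mem {ε : ℤ} (hε : ε * ε = 1) {n : ℕ}
    {y : (Fin n → Multiplicative ℤ) →₀ ℤ} (hy : chainProj n y = 0) :
    y + ε • chainNeg n y ∈ signedChains ε n := by
  rw [mem_signedChains]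
  constructor
  · rw [map_add, map_smul, chainProj_chainNeg, hy, smul_zero, add_zero]
  · rw [map_add, map_smul, chainNeg_chainNeg, smul_add, smul_smul, hε, one_smul, add_comm]

theorem mem_signedChains_neg {ε : ℤ} (hε : ε * ε = 1) {n : ℕ}
    {y : (Fin n → Multiplicative ℤ) →₀ ℤ} (hy : chainProj n y = 0)
    (h : y + ε • chainNeg n y = 0) : y ∈ signedChains (-ε) n := by
  refine mem_signedChains.2 ⟨hy, ?_⟩
  have := congrArg (fun z => ε • z) h
  simp only [smul_add, smul_smul, hε, one_smul, smul_zero] at this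
  rw [neg_smul]
  exact eq_neg_of_add_eq_zero_right this

theorem add_smul_chainNeg_eq_zero {ε : ℤ} (hε : ε * ε = 1) {n : ℕ}
    {y : (Fin n → Multiplicative ℤ) →₀ ℤ} (hy : y ∈ signedChains (-ε) n) :
    y + ε • chainNeg n y = 0 := by
  rw [(mem_signedChains.1 hy).2, smul_smul, mul_neg, hε, neg_one_smul, add_neg_cancel]

theorem chainD_add_smul_chainNeg (ε : ℤ) (n : ℕ) (y : (Fin (n + 1) → Multiplicative ℤ) →₀ ℤ) :
    chainD (Multiplicative ℤ) ℤ n (y + ε • chainNeg (n + 1) y) =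
      chainD (Multiplicative ℤ) ℤ n y + ε • chainNeg n (chainD (Multiplicative ℤ) ℤ n y) := by
  rw [map_add, map_smul, chainD_chainNeg]

theorem exists_chainProj_eq_zero_and_chainD_eq {n : ℕ}
    {x : (Fin (n + 1) → Multiplicative ℤ) →₀ ℤ} (hp : chainProj (n + 1) x = 0)
    (h : ∃ y, chainD (Multiplicative ℤ) ℤ (n + 1) y = x) :
    ∃ y, chainProj (n + 2) y = 0 ∧ chainD (Multiplicative ℤ) ℤ (n + 1) y = x := by
  obtain ⟨y, rfl⟩ := h
  refine ⟨y - chainProj _ y, by rw [map_sub, chainProj_chainProj, sub_self], ?_⟩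
  rw [map_sub, chainD_chainProj, hp, sub_zero]

theorem exists_of_degreeOne_eq_zero {x : (Fin 1 → Multiplicative ℤ) →₀ ℤ}
    (hp : chainProj 1 x = 0) (h : degreeOne x = 0) :
    ∃ y, chainProj 2 y = 0 ∧ chainD (Multiplicative ℤ) ℤ 1 y = x := by
  refine exists_chainProj_eq_zero_and_chainD_eq hp ?_
  obtain ⟨y, hy⟩ := exists_chainD_eq_sub x
  exact ⟨y, by rw [hy, h, zero_smul, sub_zero]⟩

theorem exists_of_chainD_eq_zero {n : ℕ} {x : (Fin (n + 2) → Multiplicative ℤ) →₀ ℤ}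
    (hp : chainProj (n + 2) x = 0) (h : chainD (Multiplicative ℤ) ℤ (n + 1) x = 0) :
    ∃ y, chainProj (n + 3) y = 0 ∧ chainD (Multiplicative ℤ) ℤ (n + 2) y = x :=
  exists_chainProj_eq_zero_and_chainD_eq hp (exists_chainD_eq n x h)

/-! ### Dimension shifting between the two signs -/

/-- The signed chains of sign `ε` are exact in degree `n + 1`. -/
def SignedExact (ε : ℤ) (n : ℕ) : Prop :=
  ∀ x ∈ signedChains ε (n + 1), chainD (Multiplicative ℤ) ℤ n x = 0 →
    ∃ y ∈ signedChains ε (n + 2), chainD (Multiplicative ℤ) ℤ (n + 1) y = x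

/-- The homology of the signed chains of sign `ε` in degree `n + 1` has exactly two elements, and
the nonzero one vanishes in the homology of all chains. -/
def SignedTwo (ε : ℤ) (n : ℕ) : Prop :=
  ∃ v, chainProj (n + 2) v = 0 ∧
    chainD (Multiplicative ℤ) ℤ (n + 1) v ∈ signedChains ε (n + 1) ∧
    (∀ y ∈ signedChains ε (n + 2),
      chainD (Multiplicative ℤ) ℤ (n + 1) y ≠ chainD (Multiplicative ℤ) ℤ (n + 1) v) ∧
    ∀ x ∈ signedChains ε (n + 1), chainD (Multiplicative ℤ) ℤ n x = 0 →
      ∃ y ∈ signedChains ε (n + 2), chainD (Multiplicative ℤ) ℤ (n + 1) y = x ∨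
        chainD (Multiplicative ℤ) ℤ (n + 1) y = x - chainD (Multiplicative ℤ) ℤ (n + 1) v

/-- Injectivity of the connecting map: lift a cycle `x` to `y` with `x = y + ετy`. Then `dy` is a
cycle of sign `-ε`, so `dy = dz` with `z` of sign `-ε`, and `y - z = dw`. As `1 + ετ` kills `z`, it
sends `w` to a chain bounding `x`. -/
theorem SignedExact.succ {ε : ℤ} (hε : ε * ε = 1) {n : ℕ} (h : SignedExact (-ε) n) :
    SignedExact ε (n + 1) := by
  intro x hx hdx
  obtain ⟨y, hy, rfl⟩ := exists_eq_add_smul_chainNeg _ hε (mem_signedChains.1 hx).2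
    (mem_signedChains.1 hx).1
  rw [chainD_add_smul_chainNeg] at hdx
  have hdy := mem_signedChains_neg hε (by rw [← chainD_chainProj, hy, map_zero]) hdx
  obtain ⟨z, hz, hdz⟩ := h _ hdy (chainD_chainD _ _)
  obtain ⟨w, hw, hdw⟩ := exists_of_chainD_eq_zero (x := y - z)
    (by rw [map_sub, hy, (mem_signedChains.1 hz).1, sub_zero]) (by rw [map_sub, hdz, sub_self])
  refine ⟨_, add_smul_chainNeg_mem hε hw, ?_⟩
  rw [chainD_add_smul_chainNeg, hdw, ← sub_eq_zero, ← neg_eq_zero,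
    ← add_smul_chainNeg_eq_zero hε hz, map_sub, smul_sub]
  abel

/-- The connecting map sends the class of `v + ετv` to that of `dv`. Having `v` as part of the data
replaces acyclicity of all chains in the lower degree, which fails when that degree is one. -/
theorem SignedTwo.succ {ε : ℤ} (hε : ε * ε = 1) {n : ℕ} (h : SignedTwo (-ε) n) :
    SignedTwo ε (n + 1) := by
  obtain ⟨v, hv, hdv, hne, H⟩ := h
  have hmem := add_smul_chainNeg_mem hε hv
  have hd : chainD (Multiplicative ℤ) ℤ (n + 1) (v + ε • chainNeg (n + 2) v) = 0 := by
    rw [chainD_add_smul_chainNeg, add_smul_chainNeg_eq_zero hε hdv]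
  obtain ⟨v', hv', hdv'⟩ := exists_of_chainD_eq_zero (mem_signedChains.1 hmem).1 hd
  refine ⟨v', hv', hdv' ▸ hmem, fun w hw hdw => ?_, fun x hx hdx => ?_⟩
  · obtain ⟨t, ht, rfl⟩ := exists_eq_add_smul_chainNeg _ hε (mem_signedChains.1 hw).2
      (mem_signedChains.1 hw).1
    -- If `v + ετv` bounded `t + ετt`, then `v - dt` would be killed by `1 + ετ`, so of sign `-ε`,
    -- with the same boundary as `v`.
    refine hne (v - chainD (Multiplicative ℤ) ℤ (n + 2) t) (mem_signedChains_neg hε ?_ ?_) ?_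
    · rw [map_sub, hv, ← chainD_chainProj, ht, map_zero, sub_zero]
    · rw [chainD_add_smul_chainNeg, hdv', ← sub_eq_zero] at hdw
      rw [← neg_eq_zero, ← hdw, map_sub, smul_sub]
      abel
    · rw [map_sub, chainD_chainD, sub_zero]
  · obtain ⟨y, hy, rfl⟩ := exists_eq_add_smul_chainNeg _ hε (mem_signedChains.1 hx).2
      (mem_signedChains.1 hx).1
    rw [chainD_add_smul_chainNeg] at hdx
    have hdy := mem_signedChains_neg hε (by rw [← chainD_chainProj, hy, map_zero]) hdx
    -- The class of `dy` is zero or that of `dv`; accordingly `y - z` or `y - v - z` is a cycle,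
    -- hence a boundary.
    obtain ⟨z, hz, hdz⟩ := H _ hdy (chainD_chainD _ _)
    have hz0 := add_smul_chainNeg_eq_zero hε hz
    rcases hdz with hdz | hdz
    · obtain ⟨w, hw, hdw⟩ := exists_of_chainD_eq_zero (x := y - z)
        (by rw [map_sub, hy, (mem_signedChains.1 hz).1, sub_zero])
        (by rw [map_sub, hdz, sub_self])
      refine ⟨_, add_smul_chainNeg_mem hε hw, Or.inl ?_⟩
      rw [chainD_add_smul_chainNeg, hdw, ← sub_eq_zero, ← neg_eq_zero, ← hz0, map_sub, smul_sub]
      abel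
    · obtain ⟨w, hw, hdw⟩ := exists_of_chainD_eq_zero (x := y - v - z)
        (by rw [map_sub, map_sub, hy, hv, (mem_signedChains.1 hz).1, sub_zero, sub_zero])
        (by rw [map_sub, map_sub, hdz, sub_self])
      refine ⟨_, add_smul_chainNeg_mem hε hw, Or.inr ?_⟩
      rw [chainD_add_smul_chainNeg, hdw, hdv', ← sub_eq_zero, ← neg_eq_zero, ← hz0, map_sub,
        map_sub, smul_sub, smul_sub]
      abel

/-! ### Degrees one and two, by parity -/

theorem degreeOne_chainNeg (x : (Fin 1 → Multiplicative ℤ) →₀ ℤ) :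
    degreeOne (chainNeg 1 x) = -degreeOne x := by
  have h : degreeOne ∘ₗ chainNeg 1 = -degreeOne :=
    Finsupp.lhom_ext fun g m => by simp [chainNeg_single, degreeOne_single]
  exact LinearMap.congr_fun h x

theorem degreeOne_chainProj (x : (Fin 1 → Multiplicative ℤ) →₀ ℤ) :
    degreeOne (chainProj 1 x) = 0 := by
  have h : degreeOne ∘ₗ chainProj 1 = 0 :=
    Finsupp.lhom_ext fun g m => by simp [chainProj_single, degreeOne_single]
  exact LinearMap.congr_fun h x

theorem exists_degreeOne_eq_one : ∃ a, chainProj 1 a = 0 ∧ degreeOne a = 1 := by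
  refine ⟨genOne - chainProj 1 genOne, by rw [map_sub, chainProj_chainProj, sub_self], ?_⟩
  rw [map_sub, degreeOne_chainProj, genOne, degreeOne_single]
  rfl

theorem even_degreeOne {x : (Fin 1 → Multiplicative ℤ) →₀ ℤ} (hx : x ∈ signedChains (-1) 1) :
    ∃ s, chainProj 1 s = 0 ∧ x = s - chainNeg 1 s ∧ degreeOne x = 2 * degreeOne s := by
  obtain ⟨s, hs, rfl⟩ := exists_eq_add_smul_chainNeg _ (by norm_num) (mem_signedChains.1 hx).2
      (mem_signedChains.1 hx).1
  refine ⟨s, hs, by rw [neg_one_smul, sub_eq_add_neg], ?_⟩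
  rw [map_add, map_smul, degreeOne_chainNeg, smul_eq_mul]
  ring

/-- The nonzero class is `a + τa` with `a` of degree one. It has degree zero, so it bounds some `v`
in the kernel of `chainProj`; parity of the degree keeps it from bounding an invariant chain. -/
theorem signedTwo_one_zero : SignedTwo 1 0 := by
  obtain ⟨a, ha, ha1⟩ := exists_degreeOne_eq_one
  have hε : (1 : ℤ) * 1 = 1 := by norm_num
  have hmem := add_smul_chainNeg_mem hε ha
  have hdeg : degreeOne (a + (1 : ℤ) • chainNeg 1 a) = 0 := by
    rw [one_smul, map_add, degreeOne_chainNeg, add_neg_cancel]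
  obtain ⟨v, hv, hdv⟩ := exists_of_degreeOne_eq_zero (mem_signedChains.1 hmem).1 hdeg
  refine ⟨v, hv, hdv ▸ hmem, fun w hw hdw => ?_, fun x hx _ => ?_⟩
  · obtain ⟨t, ht, rfl⟩ := exists_eq_add_smul_chainNeg _ hε (mem_signedChains.1 hw).2
      (mem_signedChains.1 hw).1
    have hs : a - chainD (Multiplicative ℤ) ℤ 1 t ∈ signedChains (-1) 1 := by
      refine mem_signedChains_neg hε ?_ ?_
      · rw [map_sub, ha, ← chainD_chainProj, ht, map_zero, sub_zero]
      · rw [chainD_add_smul_chainNeg, hdv, ← sub_eq_zero] at hdw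
        rw [← neg_eq_zero, ← hdw, map_sub, smul_sub]
        abel
    obtain ⟨s, -, -, h2⟩ := even_degreeOne hs
    rw [map_sub, degreeOne_chainD, ha1] at h2
    omega
  · obtain ⟨y, hy, rfl⟩ := exists_eq_add_smul_chainNeg _ hε (mem_signedChains.1 hx).2
      (mem_signedChains.1 hx).1
    obtain ⟨k, hk⟩ := Int.even_or_odd' (degreeOne y)
    -- The chain `a - τa` has degree two and is killed by `1 + τ`, so multiples of it adjust the
    -- degree of `y` by any even number without changing `x = y + τy`.
    have hk0 : a - chainNeg 1 a + (1 : ℤ) • chainNeg 1 (a - chainNeg 1 a) = 0 := by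
      rw [map_sub, chainNeg_chainNeg, one_smul]
      abel
    have hkd : degreeOne (a - chainNeg 1 a) = 2 := by
      rw [map_sub, degreeOne_chainNeg, ha1]; norm_num
    have hka : chainProj 1 (a - chainNeg 1 a) = 0 := by
      rw [map_sub, chainProj_chainNeg, sub_self]
    generalize a - chainNeg 1 a = b at hk0 hkd hka
    have hkb : k • chainNeg 1 b = -(k • b) := by
      rw [one_smul] at hk0
      rw [eq_neg_of_add_eq_zero_right hk0, smul_neg]
    rcases hk with hk | hk
    · obtain ⟨w, hw, hdw⟩ := exists_of_degreeOne_eq_zero (x := y - k • b)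
        (by rw [map_sub, map_smul, hy, hka, smul_zero, sub_zero])
        (by rw [map_sub, map_smul, hk, hkd, smul_eq_mul]; ring)
      refine ⟨_, add_smul_chainNeg_mem hε hw, Or.inl ?_⟩
      rw [chainD_add_smul_chainNeg, hdw]
      simp only [map_sub, map_smul, hkb, one_smul]
      abel
    · obtain ⟨w, hw, hdw⟩ := exists_of_degreeOne_eq_zero (x := y - a - k • b)
        (by rw [map_sub, map_sub, map_smul, hy, ha, hka, smul_zero, sub_zero, sub_zero])
        (by rw [map_sub, map_sub, map_smul, hk, hkd, ha1, smul_eq_mul]; ring)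
      refine ⟨_, add_smul_chainNeg_mem hε hw, Or.inr ?_⟩
      rw [chainD_add_smul_chainNeg, hdw, hdv]
      simp only [map_sub, map_smul, hkb, one_smul]
      abel

/-- Here `dy = s - τs` has degree `0 = 2 deg s`, so `s = dr`. Then `y - (r - τr)` is a cycle, hence
a boundary `dw`, and `1 + τ` kills `r - τr`. -/
theorem signedExact_one_one : SignedExact 1 1 := by
  have hε : (1 : ℤ) * 1 = 1 := by norm_num
  intro x hx hdx
  obtain ⟨y, hy, rfl⟩ := exists_eq_add_smul_chainNeg _ hε (mem_signedChains.1 hx).2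
    (mem_signedChains.1 hx).1
  rw [chainD_add_smul_chainNeg] at hdx
  have hdy := mem_signedChains_neg hε (by rw [← chainD_chainProj, hy, map_zero]) hdx
  obtain ⟨s, hs, hs', h2⟩ := even_degreeOne hdy
  rw [degreeOne_chainD] at h2
  obtain ⟨r, hr, hdr⟩ := exists_of_degreeOne_eq_zero hs (by omega)
  obtain ⟨w, hw, hdw⟩ := exists_of_chainD_eq_zero (x := y - (r - chainNeg 2 r))
    (by rw [map_sub, map_sub, chainProj_chainNeg, hy, sub_self, sub_zero])
    (by rw [map_sub, map_sub, chainD_chainNeg, hdr, hs', sub_self])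
  refine ⟨_, add_smul_chainNeg_mem hε hw, ?_⟩
  rw [chainD_add_smul_chainNeg, hdw]
  simp only [map_sub, chainNeg_chainNeg, one_smul]
  abel

theorem signed_two_mul (m : ℕ) : SignedTwo 1 (2 * m) ∧ SignedExact 1 (2 * m + 1) := by
  induction m with
  | zero => exact ⟨signedTwo_one_zero, signedExact_one_one⟩
  | succ m ih =>
    have h1 : (-1 : ℤ) * -1 = 1 := by norm_num
    have h2 : (1 : ℤ) * 1 = 1 := by norm_num
    exact ⟨(ih.1.succ (ε := -1) h1).succ h2, (ih.2.succ (ε := -1) h1).succ h2⟩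

/-! ### Adding back the chains of the trivial subgroup -/

/-- The trivial subgroup is a retract, so its homology inherits the vanishing above degree one; in
degree one the surviving invariant, the degree, is killed by `chainProj`. -/
theorem exists_chainD_eq_chainProj {n : ℕ} {x : (Fin (n + 1) → Multiplicative ℤ) →₀ ℤ}
    (hx : chainD (Multiplicative ℤ) ℤ n x = 0) :
    ∃ y, chainD (Multiplicative ℤ) ℤ (n + 1) (chainProj (n + 2) y) = chainProj (n + 1) x := by
  cases n with
  | zero =>
    obtain ⟨y, hy⟩ := exists_chainD_eq_sub (chainProj 1 x)
    exact ⟨y, by rw [chainD_chainProj, hy, degreeOne_chainProj, zero_smul, sub_zero,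
      chainProj_chainProj]⟩
  | succ n =>
    obtain ⟨y, hy⟩ := exists_chainD_eq n x hx
    exact ⟨y, by rw [chainD_chainProj, hy]⟩

theorem sub_chainProj_mem {n : ℕ} {x : (Fin n → Multiplicative ℤ) →₀ ℤ}
    (hx : chainNeg n x = x) : x - chainProj n x ∈ signedChains 1 n := by
  rw [mem_signedChains, map_sub, map_sub, chainProj_chainProj, sub_self, hx, chainNeg_chainProj,
    one_smul]
  exact ⟨rfl, rfl⟩

theorem invariant_exact (m : ℕ) {x : (Fin (2 * m + 2) → Multiplicative ℤ) →₀ ℤ}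
    (hx : chainNeg _ x = x) (hdx : chainD (Multiplicative ℤ) ℤ (2 * m + 1) x = 0) :
    ∃ y, chainNeg _ y = y ∧ chainD (Multiplicative ℤ) ℤ (2 * m + 2) y = x := by
  obtain ⟨y, hy, hdy⟩ := (signed_two_mul m).2 _ (sub_chainProj_mem hx)
    (by rw [map_sub, chainD_chainProj, hdx, map_zero, sub_zero])
  obtain ⟨z, hz⟩ := exists_chainD_eq_chainProj hdx
  refine ⟨y + chainProj _ z, ?_, by rw [map_add, hdy, hz, sub_add_cancel]⟩
  rw [map_add, (mem_signedChains.1 hy).2, one_smul, chainNeg_chainProj]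

theorem invariant_two (m : ℕ) :
    ∃ u, chainNeg (2 * m + 1) u = u ∧ chainD (Multiplicative ℤ) ℤ (2 * m) u = 0 ∧
      (∀ y, chainNeg _ y = y → chainD (Multiplicative ℤ) ℤ (2 * m + 1) y ≠ u) ∧
      ∀ x, chainNeg (2 * m + 1) x = x → chainD (Multiplicative ℤ) ℤ (2 * m) x = 0 →
        ∃ y, chainNeg _ y = y ∧ (chainD (Multiplicative ℤ) ℤ (2 * m + 1) y = x ∨
          chainD (Multiplicative ℤ) ℤ (2 * m + 1) y = x - u) := by
  obtain ⟨v, hv, hdv, hne, H⟩ := (signed_two_mul m).1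
  refine ⟨_, by simpa using (mem_signedChains.1 hdv).2, chainD_chainD _ _, fun y hy hdy => ?_,
    fun x hx hdx => ?_⟩
  · refine hne _ (sub_chainProj_mem hy) ?_
    rw [map_sub, chainD_chainProj, hdy, ← chainD_chainProj, hv, map_zero, sub_zero]
  · obtain ⟨y, hy, hdy⟩ := H _ (sub_chainProj_mem hx)
      (by rw [map_sub, chainD_chainProj, hdx, map_zero, sub_zero])
    obtain ⟨z, hz⟩ := exists_chainD_eq_chainProj hdx
    refine ⟨y + chainProj _ z, ?_, ?_⟩
    · rw [map_add, (mem_signedChains.1 hy).2, one_smul, chainNeg_chainProj]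
    · rw [map_add, hz]
      rcases hdy with hdy | hdy <;> rw [hdy]
      · left; abel
      · right; abel

end EquivariantBar

end

noncomputable section

namespace EquivariantBar

open Multiplicative

/-! ### From chains to homology groups -/

theorem nat_card_homology_eq_two {R : Type} [Ring R] (S : ShortComplex (ModuleCat.{0} R))
    (u : S.X₂) (hu : S.g u = 0) (hne : ∀ y, S.f y ≠ u)
    (H : ∀ x, S.g x = 0 → ∃ y, S.f y = x ∨ S.f y = x - u) : Nat.card S.homology = 2 := by
  let B := LinearMap.range S.moduleCatToCycles
  let e : S.homology ≃ₗ[R] (LinearMap.ker S.g.hom ⧸ B) := S.moduleCatHomologyIso.toLinearEquiv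
  rw [Nat.card_congr e.toEquiv, Nat.card_eq_two_iff]
  refine ⟨0, B.mkQ ⟨u, hu⟩, fun h => ?_, Set.eq_univ_of_forall fun z => ?_⟩
  · obtain ⟨y, hy⟩ := (Submodule.Quotient.mk_eq_zero B).1 h.symm
    exact hne y (congrArg Subtype.val hy)
  · obtain ⟨⟨x, hx⟩, rfl⟩ := B.mkQ_surjective z
    obtain ⟨y, hy | hy⟩ := H x hx
    · exact Or.inl ((Submodule.Quotient.mk_eq_zero B).2 ⟨y, Subtype.ext hy⟩)
    · exact Or.inr ((Submodule.Quotient.eq B).2 ⟨y, Subtype.ext hy⟩)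

theorem subsingleton_homology (S : ShortComplex (ModuleCat.{0} ℤ))
    (H : ∀ x, S.g x = 0 → ∃ y, S.f y = x) : Subsingleton S.homology :=
  ModuleCat.subsingleton_of_isZero
    ((S.exact_iff_isZero_homology).1 (S.moduleCat_exact_iff.2 H))

theorem invariantComplex_d_apply (n : ℕ)
    (x : (chainAction negAction ℤ (n + 1)).invariants) :
    (((invariantComplex negAction ℤ).d (n + 1) n).hom x : (chainAction negAction ℤ n).invariants).1
      = chainD (Multiplicative ℤ) ℤ n x.1 := by
  have hd : (barComplex negAction ℤ).d (n + 1) n =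
      Rep.ofHom ⟨chainD (Multiplicative ℤ) ℤ n, chainD_comm negAction ℤ n⟩ :=
    ChainComplex.of_d (fun n => Rep.of (chainAction negAction ℤ n))
      (fun n => Rep.ofHom ⟨chainD (Multiplicative ℤ) ℤ n, chainD_comm negAction ℤ n⟩) n
  have hd' : (invariantComplex negAction ℤ).d (n + 1) n =
      (Rep.invariantsFunctor ℤ (Multiplicative (ZMod 2))).map
        (Rep.ofHom ⟨chainD (Multiplicative ℤ) ℤ n, chainD_comm negAction ℤ n⟩) := by
    rw [← hd]; rfl
  rw [hd']
  rfl

theorem mem_invariants_iff (n : ℕ) (x : (Fin n → Multiplicative ℤ) →₀ ℤ) :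
    x ∈ (chainAction negAction ℤ n).invariants ↔ chainNeg n x = x := by
  refine ⟨fun h => h (ofAdd 1), fun h q => ?_⟩
  have hq : q = 1 ∨ q = ofAdd 1 := by revert q; decide
  rcases hq with rfl | rfl
  · simp
  · exact h

/-- An invariant chain, as an element of the complex of invariant chains. -/
def invariantChain (n : ℕ) (x : (Fin n → Multiplicative ℤ) →₀ ℤ) (hx : chainNeg n x = x) :
    (invariantComplex negAction ℤ).X n :=
  (⟨x, (mem_invariants_iff n x).2 hx⟩ : (chainAction negAction ℤ n).invariants)

theorem exists_eq_invariantChain {n : ℕ} (x : (invariantComplex negAction ℤ).X n) :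
    ∃ x' hx', x = invariantChain n x' hx' :=
  ⟨(show (chainAction negAction ℤ n).invariants from x).1, (mem_invariants_iff n _).1
    (show (chainAction negAction ℤ n).invariants from x).2, rfl⟩

theorem invariantChain_inj {n : ℕ} {x y : (Fin n → Multiplicative ℤ) →₀ ℤ} {hx hy} :
    invariantChain n x hx = invariantChain n y hy ↔ x = y :=
  ⟨fun h => congrArg (fun z : (chainAction negAction ℤ n).invariants => z.1) h,
    fun h => by subst h; rfl⟩

theorem invariantChain_zero (n : ℕ) : invariantChain n 0 (map_zero _) = 0 := rfl

theorem invariantChain_sub {n : ℕ} {x y : (Fin n → Multiplicative ℤ) →₀ ℤ} (hx hy) :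
    invariantChain n x hx - invariantChain n y hy =
      invariantChain n (x - y) (by rw [map_sub, hx, hy]) := rfl

theorem invariantComplex_d_invariantChain (n : ℕ)
    (x : (Fin (n + 1) → Multiplicative ℤ) →₀ ℤ) (hx : chainNeg (n + 1) x = x) :
    (invariantComplex negAction ℤ).d (n + 1) n (invariantChain (n + 1) x hx) =
      invariantChain n (chainD (Multiplicative ℤ) ℤ n x) (by rw [← chainD_chainNeg, hx]) :=
  Subtype.ext (invariantComplex_d_apply n _)

theorem invariantComplex_exact (m : ℕ) (x : (invariantComplex negAction ℤ).X (2 * m + 2))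
    (hx : (invariantComplex negAction ℤ).d (2 * m + 2) (2 * m + 1) x = 0) :
    ∃ y, (invariantComplex negAction ℤ).d (2 * m + 3) (2 * m + 2) y = x := by
  obtain ⟨x, hx', rfl⟩ := exists_eq_invariantChain x
  rw [invariantComplex_d_invariantChain, ← invariantChain_zero, invariantChain_inj] at hx
  obtain ⟨y, hy, hdy⟩ := invariant_exact m hx' hx
  exact ⟨invariantChain _ y hy, by rwa [invariantComplex_d_invariantChain, invariantChain_inj]⟩

theorem invariantComplex_two (m : ℕ) :
    ∃ u, (invariantComplex negAction ℤ).d (2 * m + 1) (2 * m) u = 0 ∧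
      (∀ y, (invariantComplex negAction ℤ).d (2 * m + 2) (2 * m + 1) y ≠ u) ∧
      ∀ x, (invariantComplex negAction ℤ).d (2 * m + 1) (2 * m) x = 0 →
        ∃ y, (invariantComplex negAction ℤ).d (2 * m + 2) (2 * m + 1) y = x ∨
          (invariantComplex negAction ℤ).d (2 * m + 2) (2 * m + 1) y = x - u := by
  obtain ⟨u, hu, hdu, hne, H⟩ := invariant_two m
  refine ⟨invariantChain _ u hu, ?_, fun y hy => ?_, fun x hx => ?_⟩
  · rw [invariantComplex_d_invariantChain, ← invariantChain_zero, invariantChain_inj, hdu]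
  · obtain ⟨y, hy', rfl⟩ := exists_eq_invariantChain y
    rw [invariantComplex_d_invariantChain, invariantChain_inj] at hy
    exact hne y hy' hy
  · obtain ⟨x, hx', rfl⟩ := exists_eq_invariantChain x
    rw [invariantComplex_d_invariantChain, ← invariantChain_zero, invariantChain_inj] at hx
    obtain ⟨y, hy, hdy⟩ := H x hx' hx
    refine ⟨invariantChain _ y hy, ?_⟩
    rwa [invariantComplex_d_invariantChain, invariantChain_sub, invariantChain_inj,
      invariantChain_inj]

theorem augmentation_injective : Function.Injective (augmentation negAction ℤ) := by
  refine (injective_iff_map_eq_zero (augmentation negAction ℤ).hom).2 fun x hx => ?_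
  obtain ⟨x, hx', rfl⟩ := exists_eq_invariantChain x
  rw [← invariantChain_zero, invariantChain_inj]
  have h : x = Finsupp.single default (x default) := by
    refine Finsupp.ext fun g => ?_
    rw [Subsingleton.elim g default, Finsupp.single_eq_same]
  have hs : (Finsupp.lsum ℤ fun _ : Fin 0 → Multiplicative ℤ => (LinearMap.id : ℤ →ₗ[ℤ] ℤ)) x = 0 :=
    hx
  rw [h, Finsupp.lsum_single, LinearMap.id_apply] at hs
  rw [h, hs, Finsupp.single_zero]

theorem subsingleton_homology_of_exact (K : ChainComplex (ModuleCat.{0} ℤ) ℕ) (i : ℕ)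
    (H : ∀ x, K.d (i + 1) i x = 0 → ∃ y, K.d (i + 2) (i + 1) y = x) :
    Subsingleton (K.homology (i + 1)) :=
  have := subsingleton_homology (K.sc' (i + 2) (i + 1) i) H
  (K.homologyIsoSc' (i + 2) (i + 1) i (by simp) (by simp)).toLinearEquiv.injective.subsingleton

/-- The data make the homology a group of order two; prime order then determines it. -/
theorem nonempty_homology_addEquiv (K : ChainComplex (ModuleCat.{0} ℤ) ℕ) (i : ℕ)
    (H : ∃ u, K.d (i + 1) i u = 0 ∧ (∀ y, K.d (i + 2) (i + 1) y ≠ u) ∧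
      ∀ x, K.d (i + 1) i x = 0 → ∃ y, K.d (i + 2) (i + 1) y = x ∨ K.d (i + 2) (i + 1) y = x - u) :
    Nonempty (K.homology (i + 1) ≃+ ZMod 2) := by
  obtain ⟨u, hu, hne, H⟩ := H
  let e := addEquivOfPrimeCardEq (p := 2)
    (nat_card_homology_eq_two (K.sc' (i + 2) (i + 1) i) u hu hne H) (Nat.card_zmod 2)
  exact ⟨(K.homologyIsoSc' (i + 2) (i + 1) i (by simp)
    (by simp)).toLinearEquiv.toAddEquiv.trans e⟩

end EquivariantBar

end

theorem theorem4p9 :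
    (∀ i : ℕ, 0 < i →
      (Odd i → Nonempty
        (EquivariantBar.equivariantHomology EquivariantBar.negAction ℤ i ≃+ ZMod 2)) ∧
      (Even i → Subsingleton
        (EquivariantBar.equivariantHomology EquivariantBar.negAction ℤ i))) ∧
    (∀ i : ℕ,
      (Odd i → Nonempty
        (EquivariantBar.reducedEquivariantHomology EquivariantBar.negAction ℤ i ≃+ ZMod 2)) ∧
      (Even i → Subsingleton
        (EquivariantBar.reducedEquivariantHomology EquivariantBar.negAction ℤ i))) := by
  refine ⟨fun i hi => ⟨?_, fun h => ?_⟩, fun i => ⟨?_, fun h => ?_⟩⟩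
  · rintro ⟨m, rfl⟩
    exact EquivariantBar.nonempty_homology_addEquiv _ _ (EquivariantBar.invariantComplex_two m)
  · obtain ⟨m, rfl⟩ : ∃ m, i = 2 * m + 2 := by
      obtain ⟨k, rfl⟩ := h
      exact ⟨k - 1, by omega⟩
    exact EquivariantBar.subsingleton_homology_of_exact _ _
      (EquivariantBar.invariantComplex_exact m)
  · rintro ⟨m, rfl⟩
    exact EquivariantBar.nonempty_homology_addEquiv _ _ (EquivariantBar.invariantComplex_two m)
  · rcases i with _ | i
    -- In degree zero the augmentation is injective, so the only cycle is `0`.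
    · refine EquivariantBar.subsingleton_homology_of_exact _ _ fun x hx => ⟨0, ?_⟩
      rw [map_zero]
      exact (EquivariantBar.augmentation_injective (hx.trans (map_zero _).symm)).symm
    · obtain ⟨m, rfl⟩ : ∃ m, i = 2 * m + 1 := by
        obtain ⟨k, hk⟩ := h
        exact ⟨k - 1, by omega⟩
      exact EquivariantBar.subsingleton_homology_of_exact _ _
        (EquivariantBar.invariantComplex_exact m)
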